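/- Let $P_3$ be the path with three vertices $0,1,2$ (in this order), and let $P_3^n$ be the Cartesian product of $n$ copies of $P_3$: its vertex set is $\{0,1,2\}^n$, and $x,y$ are adjacent if and only if $|x_i-y_i|=1$ for some $i$ and $x_j=y_j$ for all $j\neq i$. For $p\in[0,1]$ let $P_{3,p}^n$ be the random subgraph of $P_3^n$ that contains all vertices of $P_3^n$ and each edge of $P_3^n$ independently with probability $p$. Let $C_s$ be the family of all sets $S$ of exactly $s$ vertices such that the subgraph of $P_3^n$ induced by $S$ is connected. **Theorem.** Let $p\in[0.67,1]$ be fixed. Then the probability that for some integer $s$ with $2\le s<3^n$ and some $S\in C_s$ no edge of $P_{3,p}^n$ joins $S$ to $V(P_3^n)\setminus S$ tends to $0$ as $n\to\infty$. Moreover, the probability that $P_{3,p}^n$ is connected tends to $1$ as $n\to\infty$. -/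

import Mathlib

/-- The Cartesian product of `n` copies of a graph `G`: two vertices `x`, `y` are adjacent when
they agree in all coordinates but one, and their entries in that coordinate are adjacent in `G`. -/
def SimpleGraph.cartesianPower {V : Type*} (G : SimpleGraph V) (n : ℕ) :
    SimpleGraph (Fin n → V) where
  Adj x y := ∃ i, G.Adj (x i) (y i) ∧ ∀ j, j ≠ i → x j = y j
  symm := ⟨fun _ _ ⟨i, hi, h⟩ => ⟨i, hi.symm, fun j hj => (h j hj).symm⟩⟩
  loopless := ⟨fun _ ⟨_, hi, _⟩ => hi.ne rfl⟩

/-- The graph `P₃ⁿ`: the Cartesian product of `n` copies of the path on three vertices. -/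
abbrev pathThreePower (n : ℕ) : SimpleGraph (Fin n → Fin 3) :=
  (SimpleGraph.pathGraph 3).cartesianPower n

/-- The law of the random subgraph of `G` that keeps all the vertices of `G`, and each edge of `G`
independently with probability `p`. -/
noncomputable def SimpleGraph.percolation {V : Type*} (G : SimpleGraph V) (p : unitInterval) :
    MeasureTheory.Measure (SimpleGraph V) :=
  (ProbabilityTheory.setBernoulli G.edgeSet p).map SimpleGraph.fromEdgeSet

/-- The sets of `s` vertices of `G` whose induced subgraph in `G` is connected. -/
def SimpleGraph.connectedSets {V : Type*} (G : SimpleGraph V) (s : ℕ) : Set (Finset V) :=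
  {S | S.card = s ∧ (G.induce (S : Set V)).Connected}

/-- No edge of `H` joins a vertex in `S` to a vertex outside `S`. -/
def SimpleGraph.IsCutOff {V : Type*} (H : SimpleGraph V) (S : Finset V) : Prop :=
  ∀ x ∈ S, ∀ y ∉ S, ¬ H.Adj x y

open MeasureTheory ProbabilityTheory

/-! There are at most `3 ^ n * (3 * n)` oriented edges `xy`, and the random graph is connected as
soon as the ends of each of them are joined. It therefore suffices that the ends of one edge fail to
be joined with probability at most a polynomial in `n` times `0.33 ^ n`, because `3 * 0.33 < 1`.

Each edge `xy`, in direction `i`, lies in an `n`-dimensional cube inside `P₃ⁿ`, with `x = ∅` and `y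
= {i}`. Fewer than `2 * k` open edges at `x` or at `y` in directions other than `i` cost about `(1 -
p) ^ n`. Otherwise there are open neighbours `{a}` of `x` and `{i, b}` of `y`, forming `k` pairs
with all directions distinct. Each pair is linked by almost `n` paths of length 5, one for each
further direction `j`, and all these paths are edge-disjoint. All are broken with probability about
`(1 - p ^ 5) ^ (k * n)`, and `k = 8` makes this small enough
(`IsCubeIn.percolation_not_reachable_le`).

A nonempty proper vertex set that is cut off disconnects the graph, so both claims follow. -/

/-! ### Independence over disjoint edge sets -/

theorem ProbabilityTheory.setBernoulli_superset {ι : Type*} (u : Set ι) (p : unitInterval)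
    (F : Finset ι) (hF : (F : Set ι) ⊆ u) :
    setBernoulli u p {s | (F : Set ι) ⊆ s} = ENNReal.ofReal p ^ F.card := by
  have h : ((fun P : ι → Prop ↦ {i | P i}) ⁻¹' {s | (F : Set ι) ⊆ s})
      = Set.pi F (fun _ ↦ {True}) := by
    ext P; simp [Set.subset_def, Set.mem_pi]
  rw [setBernoulli_apply', h, Measure.infinitePi_pi _ (fun _ _ ↦ .of_discrete),
    Finset.prod_congr rfl (g := fun _ ↦ ENNReal.ofReal p), Finset.prod_const]
  intro i hi
  have := hF hi
  have hp : (unitInterval.toNNReal p : ENNReal) = ENNReal.ofReal p := by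
    simp [ENNReal.ofReal, Real.toNNReal_of_nonneg p.2.1, unitInterval.toNNReal]
    rfl
  simp [this, hp]

/-- Containing several disjoint sets means containing their union, whose probability factorises.
Hence the events are independent, and so are their complements. -/
theorem ProbabilityTheory.setBernoulli_forall_not_subset_le {ι κ : Type*} [Finite ι] (u : Set ι)
    (p : unitInterval) (T : Finset κ) (E : κ → Finset ι) (L : ℕ)
    (hE : ∀ t ∈ T, (E t : Set ι) ⊆ u) (hL : ∀ t ∈ T, (E t).card ≤ L)
    (hd : (T : Set κ).PairwiseDisjoint E) :
    (setBernoulli u p).real {s | ∀ t ∈ T, ¬ (E t : Set ι) ⊆ s} ≤ (1 - (p : ℝ) ^ L) ^ T.card := by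
  classical
  let A : T → Set (Set ι) := fun t ↦ {s | (E t : Set ι) ⊆ s}
  have hA : ∀ t, MeasurableSet (A t) := fun t ↦ .of_discrete
  have hind : iIndepSet A (setBernoulli u p) := by
    rw [iIndepSet_iff_meas_biInter hA]
    intro S
    have : (⋂ t ∈ S, A t) = {s | ((S.biUnion fun t ↦ E t : Finset ι) : Set ι) ⊆ s} := by
      ext s; simp [A]
    rw [this, setBernoulli_superset _ _ _ (by simpa using fun a ha _ ↦ hE a ha),
      Finset.card_biUnion (t := fun t : T ↦ E t)
        fun a _ b _ hab ↦ hd a.2 b.2 fun h ↦ hab (Subtype.ext h),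
      ← Finset.prod_pow_eq_pow_sum]
    refine Finset.prod_congr rfl fun t _ ↦ ?_
    rw [setBernoulli_superset _ _ _ (hE t t.2)]
  have hset : {s | ∀ t ∈ T, ¬ (E t : Set ι) ⊆ s} = ⋂ t ∈ (Finset.univ : Finset T), (A t)ᶜ := by
    ext s; simp [A]
  have hm := iIndep.meas_biInter ((iIndepSet_iff_iIndep _ _).1 hind) (S := Finset.univ)
    (s := fun t ↦ (A t)ᶜ)
    fun t _ ↦ (MeasurableSpace.measurableSet_generateFrom (Set.mem_singleton _)).compl
  rw [hset, measureReal_def, hm, ENNReal.toReal_prod]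
  calc _ ≤ ∏ _t : T, (1 - (p : ℝ) ^ L) := by
        refine Finset.prod_le_prod (fun _ _ ↦ ENNReal.toReal_nonneg) fun t _ ↦ ?_
        rw [← measureReal_def, probReal_compl_eq_one_sub (hA t), measureReal_def,
          setBernoulli_superset _ _ _ (hE t t.2), ENNReal.toReal_pow,
          ENNReal.toReal_ofReal p.2.1]
        have := pow_le_pow_of_le_one p.2.1 p.2.2 (hL t t.2)
        linarith
    _ = _ := by simp

instance {V : Type*} (G : SimpleGraph V) (p : unitInterval) :
    IsProbabilityMeasure (G.percolation p) :=
  Measure.isProbabilityMeasure_map SimpleGraph.measurable_fromEdgeSet.aemeasurable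

theorem SimpleGraph.percolation_forall_not_subset_le {V κ : Type*} [Finite V] (G : SimpleGraph V)
    (p : unitInterval) (T : Finset κ) (E : κ → Finset (Sym2 V)) (L : ℕ)
    (hE : ∀ t ∈ T, (E t : Set (Sym2 V)) ⊆ G.edgeSet) (hL : ∀ t ∈ T, (E t).card ≤ L)
    (hd : (T : Set κ).PairwiseDisjoint E) :
    (G.percolation p).real {H | ∀ t ∈ T, ¬ (E t : Set (Sym2 V)) ⊆ H.edgeSet}
      ≤ (1 - (p : ℝ) ^ L) ^ T.card := by
  refine le_trans (le_of_eq ?_)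
    (setBernoulli_forall_not_subset_le G.edgeSet p T E L hE hL hd)
  have hm : MeasurableSet {H : SimpleGraph V | ∀ t ∈ T, ¬ (E t : Set (Sym2 V)) ⊆ H.edgeSet} :=
    SimpleGraph.measurable_edgeSet
      (.of_discrete : MeasurableSet {s | ∀ t ∈ T, ¬ (E t : Set (Sym2 V)) ⊆ s})
  rw [SimpleGraph.percolation, map_measureReal_apply SimpleGraph.measurable_fromEdgeSet hm]
  congr 1
  ext s
  refine forall₂_congr fun t ht ↦ not_congr ?_
  -- `fromEdgeSet` discards loops, and no `E t` contains one.
  rw [SimpleGraph.edgeSet_fromEdgeSet, Set.subset_sdiff, and_iff_left]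
  exact Set.disjoint_left.2 fun e he h ↦ G.not_isDiag_of_mem_edgeSet (hE t ht he) h

/-- If a vertex `v` of `G` has the distinct neighbours `g a` for `a ∈ D`, then it is unlikely that
at most `k` of them remain neighbours of `v` after percolation. -/
theorem SimpleGraph.percolation_card_neighbors_le {V ι : Type*} [Finite V]
    (G : SimpleGraph V) (p : unitInterval) (v : V) (g : ι → V) (hg : g.Injective) (D : Finset ι)
    (hD : ∀ a ∈ D, G.Adj v (g a)) (k : ℕ) (hk : k ≤ D.card) :
    (G.percolation p).real {H | ∃ A ⊆ D, A.card ≤ k ∧ ∀ a ∈ D, H.Adj v (g a) → a ∈ A}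
      ≤ D.card ^ k * (1 - (p : ℝ)) ^ (D.card - k) := by
  classical
  -- Enlarging `A` to exactly `k` elements leaves only `D.card.choose k` cases.
  have hsub : {H : SimpleGraph V | ∃ A ⊆ D, A.card ≤ k ∧ ∀ a ∈ D, H.Adj v (g a) → a ∈ A} ⊆
      ⋃ A ∈ D.powersetCard k, {H | ∀ a ∈ D \ A,
        ¬ (({s(v, g a)} : Finset (Sym2 V)) : Set (Sym2 V)) ⊆ H.edgeSet} := by
    rintro H ⟨A, hAD, hA, h⟩
    obtain ⟨B, hAB, hBD, hB⟩ := Finset.exists_subsuperset_card_eq hAD hA hk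
    simp only [Set.mem_iUnion, Finset.mem_powersetCard, Set.mem_ofPred_eq]
    refine ⟨B, ⟨hBD, hB⟩, fun a ha hH ↦ ?_⟩
    rw [Finset.mem_sdiff] at ha
    exact ha.2 (hAB (h a ha.1 (by simpa using hH)))
  refine (measureReal_mono hsub (measure_ne_top _ _)).trans ((measureReal_biUnion_finset_le _ _).trans ?_)
  calc _ ≤ ∑ A ∈ D.powersetCard k, (1 - (p : ℝ)) ^ (D.card - k) := by
        refine Finset.sum_le_sum fun A hA ↦ ?_
        rw [Finset.mem_powersetCard] at hA
        have := G.percolation_forall_not_subset_le p (D \ A) (fun a ↦ {s(v, g a)}) 1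
          (fun a ha ↦ by simpa using hD a (Finset.mem_sdiff.1 ha).1) (by simp)
          (fun a _ b _ hab ↦ by
            simp only [Function.onFun, Finset.disjoint_singleton]
            intro h
            have h' : g a = g b ∨ v = g b ∧ g a = v := by simpa using h
            exact hab (hg (h'.elim id fun h ↦ h.2.trans h.1)))
        rwa [Finset.card_sdiff_of_subset hA.1, hA.2, pow_one] at this
    _ ≤ _ := by
        rw [Finset.sum_const, Finset.card_powersetCard, nsmul_eq_mul]
        have : (0 : ℝ) ≤ 1 - p := sub_nonneg.2 p.2.2
        gcongr
        exact_mod_cast Nat.choose_le_pow _ _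

/-! ### Edge-disjoint paths in a cube -/

/-- The edges of the path `{a}, {a, j}, {a, j, i}, {a, j, i, b}, {j, i, b}, {i, b}` of the cube of
subsets of `ι`. -/
def cubePath {ι : Type*} [DecidableEq ι] (i a b j : ι) : Finset (Sym2 (Finset ι)) :=
  {s({a}, {j, a}), s({j, a}, {i, j, a}), s({i, j, a}, {a, j, i, b}), s({j, i, b}, {a, j, i, b}),
    s({i, b}, {j, i, b})}

theorem card_cubePath_le {ι : Type*} [DecidableEq ι] (i a b j : ι) :
    (cubePath i a b j).card ≤ 5 :=
  Finset.card_le_five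

/-- Here `e.sup` is the union of the two ends of `e`. It reveals `j` and the pair `a, b`, so an edge
determines the path it lies on. -/
theorem cubePath_sup {ι : Type*} [DecidableEq ι] {i a b j : ι} {e : Sym2 (Finset ι)}
    (he : e ∈ cubePath i a b j) :
    j ∈ e.sup ∧ (a ∈ e.sup ∨ b ∈ e.sup) ∧ e.sup ⊆ {a, b, i, j} := by
  simp only [cubePath, Finset.mem_insert, Finset.mem_singleton] at he
  rcases he with rfl | rfl | rfl | rfl | rfl <;> simp [Finset.subset_iff]

theorem disjoint_cubePath {ι κ : Type*} [DecidableEq ι] {i j j' : ι} {c : κ ⊕ κ → ι}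
    (hc : c.Injective) (hi : ∀ k, c k ≠ i) (hj : ∀ k, c k ≠ j) (hji : j ≠ i)
    (hj' : ∀ k, c k ≠ j') {k k' : κ} (h : k ≠ k' ∨ j ≠ j') :
    Disjoint (cubePath i (c (.inl k)) (c (.inr k)) j)
      (cubePath i (c (.inl k')) (c (.inr k')) j') := by
  rw [Finset.disjoint_left]
  intro e he he'
  obtain ⟨h1, h2, -⟩ := cubePath_sup he
  obtain ⟨-, -, h3⟩ := cubePath_sup he'
  have hjj : j = j' := by
    have := h3 h1
    simp only [Finset.mem_insert, Finset.mem_singleton] at this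
    rcases this with h | h | h | h
    · exact absurd h.symm (hj _)
    · exact absurd h.symm (hj _)
    · exact absurd h hji
    · exact h
  refine h.elim (fun hk ↦ ?_) fun h ↦ h hjj
  rcases h2 with h2 | h2
  all_goals
    have := h3 h2
    simp only [Finset.mem_insert, Finset.mem_singleton, hc.eq_iff, hi, hj', Sum.inl.injEq,
      Sum.inr.injEq, reduceCtorEq, or_false, false_or] at this
    exact hk this

/-- A subgraph of `G` isomorphic to the cube of subsets of `ι`. -/
structure IsCubeIn {V ι : Type*} [DecidableEq ι] (G : SimpleGraph V) (f : Finset ι → V) :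
    Prop where
  injective : f.Injective
  adj : ∀ S, ∀ j ∉ S, G.Adj (f S) (f (insert j S))

theorem IsCubeIn.cubePath_subset {V ι : Type*} [DecidableEq ι] [DecidableEq V] {G : SimpleGraph V}
    {f : Finset ι → V} (hf : IsCubeIn G f) {i a b j : ι} (hia : a ≠ i) (hib : b ≠ i) (hab : a ≠ b)
    (hj : j ≠ i) (hja : a ≠ j) (hjb : b ≠ j) :
    (((cubePath i a b j).image (Sym2.map f) : Finset (Sym2 V)) : Set (Sym2 V)) ⊆ G.edgeSet := by
  have h1 := hf.adj {a} j (by grind)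
  have h2 := hf.adj {j, a} i (by grind)
  have h3 := hf.adj {i, j, a} b (by grind)
  have h4 := hf.adj {j, i, b} a (by grind)
  have h5 := hf.adj {i, b} j (by grind)
  rw [show ({b, i, j, a} : Finset ι) = {a, j, i, b} by grind] at h3
  simp [cubePath, Set.insert_subset_iff, *]

theorem reachable_of_cubePath_subset {V ι : Type*} [DecidableEq ι] [DecidableEq V]
    {H : SimpleGraph V} {f : Finset ι → V} {i a b j : ι}
    (h : (((cubePath i a b j).image (Sym2.map f) : Finset (Sym2 V)) : Set (Sym2 V)) ⊆ H.edgeSet) :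
    H.Reachable (f {a}) (f {i, b}) := by
  simp only [cubePath, Finset.image_insert, Finset.image_singleton, Sym2.map_mk, Finset.coe_insert,
    Finset.coe_singleton, Set.insert_subset_iff, Set.singleton_subset_iff,
    SimpleGraph.mem_edgeSet] at h
  obtain ⟨h1, h2, h3, h4, h5⟩ := h
  exact h1.reachable.trans (h2.reachable.trans (h3.reachable.trans (h4.symm.reachable.trans
    h5.symm.reachable)))

/-- Once `k` elements of `A` are chosen, at least `k` of the `2 * k` elements of `B` remain. -/
theorem Finset.exists_injective_sum {ι : Type*} {A B : Finset ι} (k : ℕ)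
    (hA : k ≤ A.card) (hB : 2 * k ≤ B.card) :
    ∃ c : Fin k ⊕ Fin k → ι, c.Injective ∧ (∀ l, c (.inl l) ∈ A) ∧ ∀ l, c (.inr l) ∈ B := by
  classical
  obtain ⟨A', hA', hA'c⟩ := Finset.exists_subset_card_eq hA
  have h1 := Finset.le_card_sdiff A' B
  obtain ⟨B', hB', hB'c⟩ := Finset.exists_subset_card_eq (show k ≤ (B \ A').card by omega)
  have hd : ∀ x ∈ A', ∀ y ∈ B', x ≠ y := fun x hx y hy h ↦
    (Finset.mem_sdiff.1 (hB' hy)).2 (h ▸ hx)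
  refine ⟨Sum.elim (fun l ↦ (A'.equivFinOfCardEq hA'c).symm l)
    (fun l ↦ (B'.equivFinOfCardEq hB'c).symm l), ?_, ?_, ?_⟩
  · refine Function.Injective.sumElim (Subtype.val_injective.comp (Equiv.injective _))
      (Subtype.val_injective.comp (Equiv.injective _)) fun l l' ↦ hd _ (Subtype.coe_prop _) _
        (Subtype.coe_prop _)
  · exact fun l ↦ hA' (Subtype.coe_prop _)
  · exact fun l ↦ (Finset.mem_sdiff.1 (hB' (Subtype.coe_prop _))).1

/-- The coordinates `j` other than `i` and the values of `c`. -/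
def freeCoords {ι κ : Type*} [Fintype ι] [DecidableEq ι] [Fintype κ] (i : ι) (c : κ → ι) :
    Finset ι :=
  Finset.univ \ insert i (Finset.univ.image c)

/-- If both ends have `2 * k` open directions, disjoint choices of `k` at each end form pairs, and a
single open path between the members of a pair would join the ends. -/
theorem exists_of_not_reachable {V ι : Type*} [Fintype ι] [DecidableEq ι] [DecidableEq V]
    {H : SimpleGraph V} {f : Finset ι → V} {i : ι} (k : ℕ) (h : ¬ H.Reachable (f ∅) (f {i})) :
    (∃ A ⊆ Finset.univ.erase i, A.card ≤ 2 * k - 1 ∧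
        ∀ a ∈ Finset.univ.erase i, H.Adj (f ∅) (f {a}) → a ∈ A) ∨
      (∃ A ⊆ Finset.univ.erase i, A.card ≤ 2 * k - 1 ∧
        ∀ a ∈ Finset.univ.erase i, H.Adj (f {i}) (f {i, a}) → a ∈ A) ∨
      ∃ c : Fin k ⊕ Fin k → ι, (c.Injective ∧ ∀ l, c l ≠ i) ∧
        ∀ t ∈ (Finset.univ : Finset (Fin k)) ×ˢ freeCoords i c,
          ¬ (((cubePath i (c (.inl t.1)) (c (.inr t.1)) t.2).image (Sym2.map f) :
            Finset (Sym2 V)) : Set (Sym2 V)) ⊆ H.edgeSet := by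
  classical
  rw [or_iff_not_imp_left, or_iff_not_imp_left]
  intro hA hB
  set A := (Finset.univ.erase i).filter fun a ↦ H.Adj (f ∅) (f {a})
  set B := (Finset.univ.erase i).filter fun a ↦ H.Adj (f {i}) (f {i, a})
  have hA' : 2 * k ≤ A.card := by
    by_contra hlt
    exact hA ⟨A, Finset.filter_subset _ _, by omega, fun a ha h ↦ Finset.mem_filter.2 ⟨ha, h⟩⟩
  have hB' : 2 * k ≤ B.card := by
    by_contra hlt
    exact hB ⟨B, Finset.filter_subset _ _, by omega, fun a ha h ↦ Finset.mem_filter.2 ⟨ha, h⟩⟩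
  obtain ⟨c, hc, hcA, hcB⟩ := Finset.exists_injective_sum k (by omega : k ≤ A.card) hB'
  simp only [A, B, Finset.mem_filter, Finset.mem_erase, Finset.mem_univ, and_true] at hcA hcB
  refine ⟨c, ⟨hc, ?_⟩, fun t _ ht ↦ h ?_⟩
  · rintro (l | l)
    exacts [(hcA l).1, (hcB l).1]
  · exact (hcA t.1).2.reachable.trans ((reachable_of_cubePath_subset ht).trans
      (hcB t.1).2.symm.reachable)

theorem IsCubeIn.percolation_not_reachable_le {V ι : Type*} [Finite V] [Fintype ι] [DecidableEq ι]
    {G : SimpleGraph V} {f : Finset ι → V} (hf : IsCubeIn G f) (p : unitInterval) (i : ι) (k : ℕ)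
    (hk : 0 < k) (hn : 2 * k + 1 ≤ Fintype.card ι) :
    (G.percolation p).real {H | ¬ H.Reachable (f ∅) (f {i})} ≤
      2 * ((Fintype.card ι : ℝ) ^ (2 * k) * (1 - (p : ℝ)) ^ (Fintype.card ι - 2 * k)) +
        (Fintype.card ι : ℝ) ^ (2 * k) *
          (1 - (p : ℝ) ^ 5) ^ (k * (Fintype.card ι - (2 * k + 1))) := by
  classical
  set n := Fintype.card ι with hndef
  have hq : (0 : ℝ) ≤ 1 - p := sub_nonneg.2 p.2.2
  have hq1 : 1 - (p : ℝ) ≤ 1 := by linarith [p.2.1]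
  have hp5 : (0 : ℝ) ≤ 1 - p ^ 5 := sub_nonneg.2 (pow_le_one₀ p.2.1 p.2.2)
  have hp51 : 1 - (p : ℝ) ^ 5 ≤ 1 := by linarith [pow_nonneg p.2.1 5]
  set D := (Finset.univ : Finset ι).erase i
  have hDc : D.card = n - 1 := by simp [D, n]
  have hn1 : (1 : ℝ) ≤ n := by exact_mod_cast (by omega : 1 ≤ n)
  -- Direction `i` is excluded, so `n - 1` directions remain; at most `2 * k - 1` are open, which
  -- leaves `n - 2 * k` closed.
  have key : ((D.card : ℕ) : ℝ) ^ (2 * k - 1) * (1 - (p : ℝ)) ^ (D.card - (2 * k - 1)) ≤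
      (n : ℝ) ^ (2 * k) * (1 - (p : ℝ)) ^ (n - 2 * k) := by
    refine mul_le_mul ?_ (pow_le_pow_of_le_one hq hq1 (by omega)) (by positivity) (by positivity)
    calc ((D.card : ℕ) : ℝ) ^ (2 * k - 1) ≤ (n : ℝ) ^ (2 * k - 1) := by
          rw [hDc]; gcongr; omega
      _ ≤ _ := pow_le_pow_right₀ hn1 (by omega)
  set C : Finset (Fin k ⊕ Fin k → ι) :=
    Finset.univ.filter fun c ↦ c.Injective ∧ ∀ l, c l ≠ i
  set bad : (Fin k ⊕ Fin k → ι) → Set (SimpleGraph V) := fun c ↦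
    {H | ∀ t ∈ (Finset.univ : Finset (Fin k)) ×ˢ freeCoords i c,
      ¬ (((cubePath i (c (.inl t.1)) (c (.inr t.1)) t.2).image (Sym2.map f) :
        Finset (Sym2 V)) : Set (Sym2 V)) ⊆ H.edgeSet}
  have hbad : ∀ c ∈ C, (G.percolation p).real (bad c) ≤
      (1 - (p : ℝ) ^ 5) ^ (k * (n - (2 * k + 1))) := by
    intro c hc
    obtain ⟨hc, hci⟩ := (Finset.mem_filter.1 hc).2
    have hfree : ∀ j ∈ freeCoords i c, j ≠ i ∧ ∀ l, c l ≠ j := by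
      intro j hj
      simpa [freeCoords] using hj
    refine (G.percolation_forall_not_subset_le p _ _ 5 ?_ ?_ ?_).trans
      (pow_le_pow_of_le_one hp5 hp51 ?_)
    · intro t ht
      obtain ⟨h1, h2⟩ := hfree _ (Finset.mem_product.1 ht).2
      exact hf.cubePath_subset (hci _) (hci _) (fun h ↦ by simpa using hc h) h1 (h2 _) (h2 _)
    · exact fun t _ ↦ Finset.card_image_le.trans (card_cubePath_le ..)
    · intro t ht t' ht' htt
      obtain ⟨h1, h2⟩ := hfree _ (Finset.mem_product.1 ht).2
      obtain ⟨h1', h2'⟩ := hfree _ (Finset.mem_product.1 ht').2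
      refine (Finset.disjoint_image (Sym2.map.injective hf.injective)).2
        (disjoint_cubePath hc hci h2 h1 h2' ?_)
      by_contra! h
      exact htt (Prod.ext h.1 h.2)
    · rw [Finset.card_product, Finset.card_univ, Fintype.card_fin]
      refine Nat.mul_le_mul_left _ ?_
      have h1 := Finset.le_card_sdiff (insert i (Finset.univ.image c)) Finset.univ
      have h2 := Finset.card_insert_le i (Finset.univ.image c)
      have h3 : (Finset.univ.image c).card ≤ 2 * k :=
        Finset.card_image_le.trans (by simp [two_mul])
      rw [Finset.card_univ] at h1
      rw [freeCoords]
      omega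
  have hCc : (C.card : ℝ) ≤ (n : ℝ) ^ (2 * k) := by
    have : C.card ≤ n ^ (2 * k) := (Finset.card_filter_le _ _).trans (by simp [n, two_mul])
    exact_mod_cast this
  have hsub : {H : SimpleGraph V | ¬ H.Reachable (f ∅) (f {i})} ⊆
      {H | ∃ A ⊆ D, A.card ≤ 2 * k - 1 ∧ ∀ a ∈ D, H.Adj (f ∅) (f {a}) → a ∈ A} ∪
      ({H | ∃ A ⊆ D, A.card ≤ 2 * k - 1 ∧ ∀ a ∈ D, H.Adj (f {i}) (f {i, a}) → a ∈ A} ∪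
        ⋃ c ∈ C, bad c) := by
    intro H hH
    rcases exists_of_not_reachable k hH with h | h | ⟨c, hc, h⟩
    · exact .inl h
    · exact .inr (.inl h)
    · exact .inr (.inr (Set.mem_biUnion (by simpa [C] using hc) h))
  refine (measureReal_mono hsub (measure_ne_top _ _)).trans ((measureReal_union_le _ _).trans ?_)
  have e1 := G.percolation_card_neighbors_le p (f ∅) (fun a ↦ f {a})
    (fun a b h ↦ by simpa using hf.injective h) D (fun a _ ↦ by simpa using hf.adj ∅ a (by simp))
    (2 * k - 1) (by omega)
  have e2 := G.percolation_card_neighbors_le p (f {i}) (fun a ↦ f {i, a})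
    (fun a b h ↦ by
      have h : ({i, a} : Finset ι) = {i, b} := hf.injective h
      have ha : a ∈ ({i, b} : Finset ι) := h ▸ by simp
      have hb : b ∈ ({i, a} : Finset ι) := h ▸ by simp
      grind) D
    (fun a ha ↦ by
      have := hf.adj {i} a (by simpa using (Finset.mem_erase.1 ha).1)
      rwa [Finset.pair_comm] at this) (2 * k - 1) (by omega)
  have e3 : (G.percolation p).real (⋃ c ∈ C, bad c) ≤
      (n : ℝ) ^ (2 * k) * (1 - (p : ℝ) ^ 5) ^ (k * (n - (2 * k + 1))) := by
    refine (measureReal_biUnion_finset_le _ _).trans ((Finset.sum_le_sum hbad).trans ?_)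
    rw [Finset.sum_const, nsmul_eq_mul]
    gcongr
  have e4 := measureReal_union_le (μ := G.percolation p)
    {H | ∃ A ⊆ D, A.card ≤ 2 * k - 1 ∧ ∀ a ∈ D, H.Adj (f {i}) (f {i, a}) → a ∈ A}
    (⋃ c ∈ C, bad c)
  linarith

/-! ### The two ends of an edge of `P₃ⁿ` -/

theorem isCubeIn_piecewise {W : Type*} {n : ℕ} {G : SimpleGraph W} {x z : Fin n → W}
    (h : ∀ j, G.Adj (x j) (z j)) :
    IsCubeIn (G.cartesianPower n) (fun S : Finset (Fin n) ↦ S.piecewise z x) where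
  injective S T hST := by
    ext j
    have := congrFun hST j
    have hj := (h j).ne
    by_cases h1 : j ∈ S <;> by_cases h2 : j ∈ T <;> simp_all [eq_comm]
  adj S j hj := by
    refine ⟨j, by simpa [hj] using h j, fun l hl ↦ ?_⟩
    simp [hl]

theorem pathThreePower_percolation_not_reachable_le (n : ℕ) (hn : 17 ≤ n) (p : unitInterval)
    (hp : (0.67 : ℝ) ≤ p) (x : Fin n → Fin 3) (i : Fin n) (v : Fin 3)
    (hv : (SimpleGraph.pathGraph 3).Adj (x i) v) :
    ((pathThreePower n).percolation p).real {H | ¬ H.Reachable x (Function.update x i v)} ≤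
      3 * (n : ℝ) ^ 16 * 0.33 ^ (n - 17) := by
  classical
  have hnb : ∀ u : Fin 3, ∃ w, (SimpleGraph.pathGraph 3).Adj u w := by
    intro u
    simp only [SimpleGraph.pathGraph_adj]
    revert u
    decide
  choose g hg using hnb
  set z : Fin n → Fin 3 := fun j ↦ if j = i then v else g (x j)
  have hz : ∀ j, (SimpleGraph.pathGraph 3).Adj (x j) (z j) := by
    intro j
    by_cases h : j = i
    · subst h; simpa [z] using hv
    · simpa [z, h] using hg (x j)
  -- `8` is the least `k` with `(1 - 0.67 ^ 5) ^ k ≤ 0.33`; the `17` is `2 * 8 + 1`.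
  have := (isCubeIn_piecewise hz).percolation_not_reachable_le p i 8 (by simp) (by simpa using hn)
  simp only [Finset.piecewise_empty, Finset.piecewise_singleton, Fintype.card_fin] at this
  rw [show z i = v by simp [z]] at this
  refine this.trans ?_
  have hq : (0 : ℝ) ≤ 1 - p := sub_nonneg.2 p.2.2
  have hp5 : (0 : ℝ) ≤ 1 - p ^ 5 := sub_nonneg.2 (pow_le_one₀ p.2.1 p.2.2)
  have h1 : (1 - (p : ℝ)) ^ (n - 2 * 8) ≤ 0.33 ^ (n - 17) :=
    calc (1 - (p : ℝ)) ^ (n - 2 * 8) ≤ 0.33 ^ (n - 2 * 8) := by gcongr; linarith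
      _ ≤ _ := pow_le_pow_of_le_one (by norm_num) (by norm_num) (by omega)
  have h2 : (1 - (p : ℝ) ^ 5) ^ (8 * (n - (2 * 8 + 1))) ≤ 0.33 ^ (n - 17) := by
    have h67 : (0.67 : ℝ) ^ 5 ≤ p ^ 5 := by gcongr
    rw [pow_mul]
    refine pow_le_pow_left₀ (by positivity) ?_ _
    calc (1 - (p : ℝ) ^ 5) ^ 8 ≤ (1 - 0.67 ^ 5) ^ 8 := by gcongr
      _ ≤ _ := by norm_num
  calc _ ≤ 2 * ((n : ℝ) ^ (2 * 8) * 0.33 ^ (n - 17)) + (n : ℝ) ^ (2 * 8) * 0.33 ^ (n - 17) := by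
        gcongr
    _ = _ := by ring

/-! ### Union bound over edges and connectedness -/

theorem SimpleGraph.Preconnected.cartesianPower {W : Type*} {G : SimpleGraph W}
    (h : G.Preconnected) (n : ℕ) : (G.cartesianPower n).Preconnected := by
  classical
  intro x y
  have step : ∀ (z : Fin n → W) i v, (G.cartesianPower n).Reachable z (Function.update z i v) := by
    intro z i v
    let φ : G →g G.cartesianPower n :=
      { toFun := fun u ↦ Function.update z i u
        map_rel' := fun {a b} hab ↦ ⟨i, by simpa using hab, fun j hj ↦ by simp [hj]⟩ }
    have hφ : φ (z i) = z := Function.update_eq_self i z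
    have := (h (z i) v).map φ
    rwa [hφ] at this
  have : ∀ S : Finset (Fin n), (G.cartesianPower n).Reachable x (S.piecewise y x) := by
    intro S
    induction S using Finset.induction_on with
    | empty => simp
    | insert i S _ ih =>
      rw [Finset.piecewise_insert]
      exact ih.trans (step _ _ _)
  simpa using this Finset.univ

/-- Otherwise, reachability in `H` would propagate along the walks of the connected graph
`G.cartesianPower n`. -/
theorem exists_not_reachable_update {W : Type*} {n : ℕ} {G : SimpleGraph W} (h : G.Connected)
    {H : SimpleGraph (Fin n → W)} (hH : ¬ H.Connected) :
    ∃ (x : Fin n → W) (i : Fin n) (v : W), G.Adj (x i) v ∧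
      ¬ H.Reachable x (Function.update x i v) := by
  by_contra! hcon
  have := h.nonempty
  refine hH ⟨fun x y ↦ ?_⟩
  obtain hxy := (SimpleGraph.reachable_iff_reflTransGen _ _).1 (h.preconnected.cartesianPower n x y)
  induction hxy with
  | refl => rfl
  | @tail y z _ hyz ih =>
    obtain ⟨i, hi, hj⟩ := hyz
    have hz : Function.update y i (z i) = z := by
      ext j
      by_cases hji : j = i
      · subst hji; simp
      · simp [hji, hj j hji]
    exact ih.trans (hz ▸ hcon y i (z i) hi)

theorem pathThreePower_percolation_not_connected_le (n : ℕ) (hn : 17 ≤ n) (p : unitInterval)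
    (hp : (0.67 : ℝ) ≤ p) :
    ((pathThreePower n).percolation p).real {H | ¬ H.Connected} ≤
      9 / 0.33 ^ 17 * ((n : ℝ) ^ 17 * 0.99 ^ n) := by
  classical
  set B : Finset ((Fin n → Fin 3) × Fin n × Fin 3) :=
    Finset.univ.filter fun t ↦ (SimpleGraph.pathGraph 3).Adj (t.1 t.2.1) t.2.2
  have hsub : {H : SimpleGraph (Fin n → Fin 3) | ¬ H.Connected} ⊆
      ⋃ t ∈ B, {H | ¬ H.Reachable t.1 (Function.update t.1 t.2.1 t.2.2)} := by
    intro H hH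
    obtain ⟨x, i, v, h1, h2⟩ :=
      exists_not_reachable_update (SimpleGraph.pathGraph_connected 2) hH
    exact Set.mem_biUnion (x := (x, i, v)) (by simpa [B] using h1) h2
  refine (measureReal_mono hsub (measure_ne_top _ _)).trans
    ((measureReal_biUnion_finset_le _ _).trans ?_)
  have hB : (B.card : ℝ) ≤ 3 ^ n * (n * 3) := by
    have : B.card ≤ 3 ^ n * (n * 3) := (Finset.card_filter_le _ _).trans (by simp)
    exact_mod_cast this
  calc _ ≤ ∑ _t ∈ B, 3 * (n : ℝ) ^ 16 * 0.33 ^ (n - 17) :=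
        Finset.sum_le_sum fun t ht ↦ pathThreePower_percolation_not_reachable_le n hn p hp _ _ _
          (Finset.mem_filter.1 ht).2
    _ ≤ 3 ^ n * (n * 3) * (3 * (n : ℝ) ^ 16 * 0.33 ^ (n - 17)) := by
        rw [Finset.sum_const, nsmul_eq_mul]
        gcongr
    _ = _ := by
        -- The number `3 ^ n` of vertices is absorbed here: `3 * 0.33 = 0.99 < 1`.
        rw [pow_sub₀ _ (by norm_num) hn, show (0.99 : ℝ) = 3 * 0.33 by norm_num, mul_pow]
        ring

theorem SimpleGraph.Connected.not_isCutOff {V : Type*} [Fintype V] {H : SimpleGraph V}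
    (hH : H.Connected) {S : Finset V} (h0 : 0 < S.card) (h1 : S.card < Fintype.card V) :
    ¬ H.IsCutOff S := by
  classical
  intro h
  obtain ⟨x, hx⟩ := Finset.card_pos.1 h0
  obtain ⟨y, hy⟩ : ∃ y, y ∉ S := by
    by_contra! hall
    rw [Finset.eq_univ_iff_forall.2 hall, Finset.card_univ] at h1
    exact h1.false
  have hxy := (SimpleGraph.reachable_iff_reflTransGen _ _).1 (hH.preconnected x y)
  refine hy ?_
  clear hy
  induction hxy with
  | refl => exact hx
  | tail _ hyz ih =>
    by_contra hz
    exact h _ ih _ hz hyz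

theorem tendsto_pathThreePower_percolation_not_connected (p : unitInterval)
    (hp : (0.67 : ℝ) ≤ p) :
    Filter.Tendsto (fun n : ℕ ↦ ((pathThreePower n).percolation p).real {H | ¬ H.Connected})
      Filter.atTop (nhds 0) := by
  have hlim := (tendsto_pow_const_mul_const_pow_of_abs_lt_one 17
    (show |(0.99 : ℝ)| < 1 by norm_num [abs_lt])).const_mul (9 / 0.33 ^ 17)
  rw [mul_zero] at hlim
  refine squeeze_zero' (.of_forall fun _ ↦ measureReal_nonneg) ?_ hlim
  filter_upwards [Filter.eventually_ge_atTop 17] with n hn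
  exact pathThreePower_percolation_not_connected_le n hn p hp

theorem mainTheorem11 (p : unitInterval) (hp : (0.67 : ℝ) ≤ (p : ℝ)) :
    Filter.Tendsto
        (fun n : ℕ => ((pathThreePower n).percolation p).real
          {H | ∃ s : ℕ, 2 ≤ s ∧ s < 3 ^ n ∧
            ∃ S ∈ (pathThreePower n).connectedSets s, H.IsCutOff S})
        Filter.atTop (nhds 0) ∧
      Filter.Tendsto
        (fun n : ℕ => ((pathThreePower n).percolation p).real {H | H.Connected})
        Filter.atTop (nhds 1) := by
  have hlim := tendsto_pathThreePower_percolation_not_connected p hp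
  refine ⟨squeeze_zero (fun _ ↦ measureReal_nonneg) (fun n ↦ ?_) hlim, ?_⟩
  · refine measureReal_mono ?_ (measure_ne_top _ _)
    rintro H ⟨s, hs2, hs, S, ⟨rfl, -⟩, hcut⟩ hH
    exact SimpleGraph.Connected.not_isCutOff hH (by omega) (by simpa using hs) hcut
  · have h1 := hlim.const_sub 1
    rw [sub_zero] at h1
    refine tendsto_of_tendsto_of_tendsto_of_le_of_le h1 tendsto_const_nhds (fun n ↦ ?_)
      fun n ↦ measureReal_le_one
    have h2 := measureReal_union_le (μ := (pathThreePower n).percolation p)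
      {H | H.Connected} {H | ¬ H.Connected}
    have h3 : {H : SimpleGraph (Fin n → Fin 3) | H.Connected} ∪ {H | ¬ H.Connected} = Set.univ :=
      Set.union_compl_self _
    rw [h3, probReal_univ] at h2
    simp only
    linarith
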